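/- Let $m\ge 2$ and $n$ be even positive integers. Define signs $C_{x_1,\dots,x_n}\in\{\pm1\}$ for $x_i\in\{1,\dots,m\}$ recursively by $$C_{1,\dots,1,j}=-1 \ \text{ if } j\le \tfrac m2+1,\qquad C_{1,\dots,1,j}=1 \ \text{ if } j>\tfrac m2+1,$$ and, for $1\le r\le n-1$ and $1\le j_{n-r}\le m-1$, $$C_{1,\dots,1,1+j_{n-r},j_{n-r+1},\dots,j_n}=\begin{cases} \phantom{-}C_{1,\dots,1,j_{n-r},\,j_{n-r+1}-1,\,j_{n-r+2},\dots,j_n} & \text{if } j_{n-r+1}>1,\\ -C_{1,\dots,1,j_{n-r},\,m,\,j_{n-r+2},\dots,j_n} & \text{if } j_{n-r+1}=1.\end{cases}$$ For full correlators $E(x_1,\dots,x_n)$ of $n$ parties with $m$ settings and outcomes $\pm1$, the generalized Svetlichny expression is $\mathcal S^{\mathrm{gen}}_{n,m}=\sum_{x_1,\dots,x_n=1}^m C_{x_1,\dots,x_n}E(x_1,\dots,x_n)$. A conditional distribution $P(a_1,\dots,a_n|x_1,\dots,x_n)$ is called bilocal if it is a convex mixture of products $Q(a_K|x_K)\,R(a_{K^c}|x_{K^c})$,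 where $K$ ranges over the non-empty proper subsets of the parties and $Q,R$ are arbitrary (possibly signalling) conditional distributions. Let $\beta_{bl}$ be the maximum of $\mathcal S^{\mathrm{gen}}_{n,m}$ over bilocal $P$. Let $P_1\ne P_2$ be two distinct sets of $n$ players each, with $P_1\cap P_2\ne\varnothing$, where within each set the $n$ roles in the expression are assigned to the players in an arbitrary way. Let every player $i$ have $m$ binary observables $A^{(i)}_1,\dots,A^{(i)}_m$ (self-adjoint operators with square $\mathbf 1$) on a joint Hilbert space of arbitrary dimension, such that observables of different players commute (for instance because they act on different tensor factors), and let $\langle\cdot\rangle$ be the expectation in an arbitrary quantum state. Write $\langle\mathcal S^{\mathrm{gen}}_{n,m}\rangle_{P_k}$ for the value of the expression on the correlators $\langle\prod_i A^{(i)}_{x_i}\rangle$ of the players in $P_k$; a player in $P_1\cap P_2$ uses the same observables in both. Then $$\beta_{bl}=\frac{m^n}{2}\qquad\text{and}\qquad \langle\mathcal S^{\mathrm{gen}}_{n,m}\rangle_{P_1}^2+\langle\mathcal S^{\mathrm{gen}}_{n,m}\rangle_{P_2}^2\le 2\beta_{bl}^2 .$$ In particular, if $|\langle\mathcal S^{\mathrm{gen}}_{n,m}\rangle_{P_1}|>\beta_{bl}$,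 then $|\langle\mathcal S^{\mathrm{gen}}_{n,m}\rangle_{P_2}|<\beta_{bl}$, so genuine multipartite nonlocality, as witnessed by this expression, is monogamous. -/

import Mathlib

/-- The sign tensor of the generalized `m`-input Svetlichny expression, evaluated on the list of
settings of the parties (one entry per party). Settings are numbered `0, …, m - 1`, so the entry
`j` stands for the setting `j + 1` of the usual numbering `1, …, m`.

* `C_{1,…,1,j}` is `-1` if `j ≤ m/2 + 1` and `1` otherwise (numbering `1, …, m`);
* a leading setting `1` does not influence the coefficient;
* lowering the first setting that is not `1` by one is compensated by lowering the setting of the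
  next party cyclically by one, with a sign change when the latter wraps around from `1` to `m`. -/
def svetlichnyCoeff (m : ℕ) : List ℕ → ℤ
  | [] => 1
  | [j] => if j ≤ m / 2 then -1 else 1
  | 0 :: y :: l => svetlichnyCoeff m (y :: l)
  | (x + 1) :: 0 :: l => -svetlichnyCoeff m (x :: (m - 1) :: l)
  | (x + 1) :: (y + 1) :: l => svetlichnyCoeff m (x :: y :: l)
termination_by l => (l.length, l.headD 0)

/-- The generalized Svetlichny expression `∑ C_{x₁,…,xₙ} E(x₁,…,xₙ)` as a function of the
full correlators `E` of `n` parties with `m` settings each. -/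
def svetlichnyValue {n m : ℕ} (E : (Fin n → Fin m) → ℝ) : ℝ :=
  ∑ x : Fin n → Fin m, (svetlichnyCoeff m (List.ofFn fun k => (x k : ℕ)) : ℝ) * E x

/-- `Q x a` is, for every tuple `x` of settings, a probability distribution over the tuples `a`
of outcomes `±1` of the parties in `κ`. No locality or no-signalling is imposed. -/
def IsConditionalDistribution {κ : Type*} [Fintype κ] [DecidableEq κ] {m : ℕ}
    (Q : (κ → Fin m) → (κ → ℤˣ) → ℝ) : Prop :=
  ∀ x, (∀ a, 0 ≤ Q x a) ∧ ∑ a, Q x a = 1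

/-- `P` factorizes across the bipartition of the `n` parties into `K` and its complement; within
each of the two groups the correlations are arbitrary, possibly signalling. -/
def FactorizesAcross {n m : ℕ} (K : Finset (Fin n))
    (P : (Fin n → Fin m) → (Fin n → ℤˣ) → ℝ) : Prop :=
  ∃ (Q : ({i // i ∈ K} → Fin m) → ({i // i ∈ K} → ℤˣ) → ℝ)
    (R : ({i // i ∉ K} → Fin m) → ({i // i ∉ K} → ℤˣ) → ℝ),
    IsConditionalDistribution Q ∧ IsConditionalDistribution R ∧
      ∀ x a, P x a = Q (fun i => x i) (fun i => a i) * R (fun i => x i) (fun i => a i)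

/-- The bilocal correlations of `n` parties (those that are not genuinely multipartite nonlocal in
the sense of Svetlichny): mixtures, over all bipartitions of the parties into two non-empty groups
and over all values of a shared variable, of correlations factorizing across the bipartition. -/
def bilocalCorrelations (n m : ℕ) : Set ((Fin n → Fin m) → (Fin n → ℤˣ) → ℝ) :=
  convexHull ℝ {P | ∃ K : Finset (Fin n), K.Nonempty ∧ Kᶜ.Nonempty ∧ FactorizesAcross K P}

/-- The full correlators `⟨a₁ ⋯ aₙ⟩` of the conditional distribution `P`. -/
def fullCorrelator {n m : ℕ} (P : (Fin n → Fin m) → (Fin n → ℤˣ) → ℝ) (x : Fin n → Fin m) : ℝ :=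
  ∑ a : Fin n → ℤˣ, P x a * (((∏ i, a i : ℤˣ) : ℤ) : ℝ)

/-- A quantum state and local measurements of `±1`-valued observables, `m` for every player in `ι`,
on a joint Hilbert space `H`. The state is a positive normalized functional on the bounded operators
(for instance `T ↦ Tr (ρ T)` for a density operator `ρ`, or a vector state); observables of
different players commute. A tensor product `H = ⨂ Hᵢ`, of any dimension, with observables of
player `i` acting on the factor `Hᵢ` only, is a special case. -/
structure QuantumStrategy (ι : Type*) (m : ℕ) (H : Type*) [NormedAddCommGroup H]
    [InnerProductSpace ℂ H] [CompleteSpace H] where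
  /-- the state, as the map sending an operator to its expectation value -/
  state : (H →L[ℂ] H) →ₗ[ℂ] ℂ
  state_one : state 1 = 1
  state_nonneg : ∀ T : H →L[ℂ] H, 0 ≤ (state (star T * T)).re ∧ (state (star T * T)).im = 0
  /-- the observable measured by a player on a given setting -/
  obs : ι → Fin m → (H →L[ℂ] H)
  obs_selfAdjoint : ∀ i x, IsSelfAdjoint (obs i x)
  obs_sq : ∀ i x, obs i x * obs i x = 1
  obs_commute : ∀ i j, i ≠ j → ∀ x y, Commute (obs i x) (obs j y)

/-- The quantum full correlator `⟨∏ₖ A^{(e k)}_{x k}⟩` of the players `e 0, …, e (n - 1)`. For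
distinct players the product is a self-adjoint operator that does not depend on the order of its
factors, and its expectation value is real. -/
noncomputable def QuantumStrategy.correlator {ι : Type*} {m : ℕ} {H : Type*}
    [NormedAddCommGroup H] [InnerProductSpace ℂ H] [CompleteSpace H]
    (s : QuantumStrategy ι m H) {n : ℕ} (e : Fin n → ι) (x : Fin n → Fin m) : ℝ :=
  (s.state (List.ofFn fun k => s.obs (e k) (x k)).prod).re

/-!
The coefficient of the settings `x` is a square wave, antiperiodic with period `m`, evaluated at an
alternating sum of the settings (`svetlichnyCoeff_ofFn`). Shifting the setting of one party
cyclically by `m/2` moves this sum by a quarter of the full period `2 m`. Hence, for two parties `p`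
and `q`, the four coefficients obtained by applying or not applying this shift to `p` and to `q`
have product `-1` (`realCoeff_chsh`): they are the signs of a Clauser–Horne–Shimony–Holt (CHSH)
expression for `p` and `q`, the other settings being fixed. Since the shifts permute the settings,
the whole expression is a quarter of the sum of these `m ^ n` CHSH expressions
(`four_mul_sum_eq_sum_block`).

*Bilocal bound.* If the correlations factorize across a bipartition, take `p` and `q` on different
sides. Each CHSH expression is then at most `2`, which gives `m ^ n / 2`, and convexity extends the
bound to mixtures. It is attained across `{p}` and its complement: `p` always answers `1` and the
others produce the common sign of those coefficients, as functions of the setting of `p`, that are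
not cancelled by their shift (`realCoeff_update_halfTurn`).

*Monogamy.* Take `p` in both sets of players, `q₁` only in the first and `q₂` only in the second.
Both expressions are averaged over the settings of all players of the union, and `q₁` and `q₂` are
shifted simultaneously. For fixed settings the observables of the remaining players, which agree on
the common ones, are absorbed into those of `q₁` and of `q₂`. This leaves two CHSH expressions that
share the observables of `p` and whose other observables commute with each other. Their expectation
values `α`, `β` satisfy `α² + β² ≤ 8` (`QuantumStrategy.chsh_monogamy`), and averaging over the
settings gives the claim.
-/

/-! ### The square wave behind the coefficients -/

/-- The square wave of period `2 m`, equal, for even `m`, to `-1` on the block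
`-m/2 + 1, …, m/2` and to `1` on the next `m` integers. -/
def squareWave (m : ℕ) (k : ℤ) : ℤˣ :=
  -((k + (m / 2 : ℕ) - 1) / (m : ℤ)).negOnePow

theorem squareWave_add_period {m : ℕ} (hm0 : 0 < m) (k : ℤ) :
    squareWave m (k + m) = -squareWave m k := by
  have h : (k + m + (m / 2 : ℕ) - 1) / (m : ℤ) = (k + (m / 2 : ℕ) - 1) / (m : ℤ) + 1 := by
    rw [show k + m + (m / 2 : ℕ) - 1 = k + (m / 2 : ℕ) - 1 + (m : ℤ) by ring,
      Int.add_ediv_of_dvd_right (dvd_refl _), Int.ediv_self (by omega)]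
  rw [squareWave, squareWave, h, Int.negOnePow_succ]

theorem squareWave_sub_period {m : ℕ} (hm0 : 0 < m) (k : ℤ) :
    squareWave m (k - m) = -squareWave m k := by
  rw [← neg_eq_iff_eq_neg, ← squareWave_add_period hm0, sub_add_cancel]

theorem squareWave_of_lt {m : ℕ} (hm : Even m) {j : ℕ} (hj : j < m) :
    (squareWave m j : ℤ) = if j ≤ m / 2 then -1 else 1 := by
  obtain ⟨h, rfl⟩ := hm
  have h2 : (h + h) / 2 = h := by omega
  rw [squareWave, h2]
  split_ifs with hc
  · rw [Int.ediv_eq_zero_of_lt (by omega) (by push_cast; omega)]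
    simp
  · have : ((j : ℤ) + h - 1) / ((h + h : ℕ) : ℤ) = 1 := by
      rw [Int.ediv_eq_iff_of_pos (by omega)]
      push_cast
      constructor <;> omega
    rw [this]
    simp

/-- Between two points at distance `m/2` where the square wave agrees it does not change sign,
since its jumps are `m` apart. -/
theorem squareWave_eq_of_between {m : ℕ} (hm : Even m) (hm0 : 0 < m) {a b : ℤ}
    (hab : a ≤ b) (hba : b ≤ a + (m / 2 : ℕ))
    (h : squareWave m a = squareWave m (a + (m / 2 : ℕ))) : squareWave m b = squareWave m a := by
  obtain ⟨l, rfl⟩ := hm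
  have h2 : (l + l) / 2 = l := by omega
  rw [h2] at hba h
  unfold squareWave at h ⊢
  rw [h2] at h ⊢
  have hpos : (0 : ℤ) ≤ ((l + l : ℕ) : ℤ) := by omega
  have h1 := Int.ediv_le_ediv (a := a + l - 1) (b := b + l - 1) (c := ((l + l : ℕ) : ℤ))
    (by omega) (by omega)
  have h3 := Int.ediv_le_ediv (a := b + l - 1) (b := a + l + l - 1) (c := ((l + l : ℕ) : ℤ))
    (by omega) (by omega)
  have h4 : (a + l + l - 1) / ((l + l : ℕ) : ℤ) ≤ (a + l - 1) / ((l + l : ℕ) : ℤ) + 1 := by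
    calc _ ≤ (a + l - 1 + ((l + l : ℕ) : ℤ)) / ((l + l : ℕ) : ℤ) :=
          Int.ediv_le_ediv (by omega) (by push_cast; omega)
      _ = _ := by
          rw [Int.add_ediv_of_dvd_right (dvd_refl _), Int.ediv_self (by omega)]
  rw [neg_inj, Int.negOnePow_eq_iff] at h
  rw [neg_inj]
  obtain ⟨t, ht⟩ := h
  congr 1
  omega

/-- The sum of the entries of a list with alternating signs, the last entry being positive. -/
def signedSum : List ℕ → ℤ
  | [] => 0
  | x :: l => (-1) ^ l.length * x + signedSum l

theorem svetlichnyCoeff_eq_squareWave {m : ℕ} (hm : Even m) (hm0 : 0 < m) (l : List ℕ)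
    (hl : ∀ x ∈ l, x < m) (hne : l ≠ []) :
    svetlichnyCoeff m l = squareWave m (signedSum l) := by
  induction l using svetlichnyCoeff.induct m with
  | case1 => exact absurd rfl hne
  | case2 j _ | case3 j _ =>
    rw [svetlichnyCoeff, ← squareWave_of_lt hm (hl j (by simp))]
    simp [signedSum]
  | case4 y l ih =>
    rw [svetlichnyCoeff, ih (fun x hx => hl x (List.mem_cons_of_mem _ hx)) (by simp)]
    simp [signedSum]
  | case5 x l ih =>
    have hx := hl (x + 1) (by simp)
    rw [svetlichnyCoeff, ih ?_ (by simp), ← Units.val_neg]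
    · congr 1
      rcases neg_one_pow_eq_or ℤ l.length with h | h
      · rw [← squareWave_sub_period hm0]
        simp only [signedSum, List.length_cons, pow_succ, h]
        push_cast [Nat.cast_sub hm0]
        congr 1; ring
      · rw [← squareWave_add_period hm0]
        simp only [signedSum, List.length_cons, pow_succ, h]
        push_cast [Nat.cast_sub hm0]
        congr 1; ring
    · simp only [List.mem_cons] at hl ⊢
      rintro z (rfl | rfl | hz)
      · omega
      · omega
      · exact hl z (by simp [hz])
  | case6 x y l ih =>
    rw [svetlichnyCoeff, ih ?_ (by simp)]
    · congr 2
      simp only [signedSum, List.length_cons, pow_succ]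
      push_cast
      ring
    · simp only [List.mem_cons] at hl ⊢
      have h1 := hl (x + 1) (by simp)
      have h2 := hl (y + 1) (by simp)
      rintro z (rfl | rfl | hz)
      · omega
      · omega
      · exact hl z (by simp [hz])

/-- The combination `∑ ± xₖ` of the settings on which the coefficient depends; the signs alternate
and the last party has sign `+`. -/
def phase {n m : ℕ} (x : Fin n → Fin m) : ℤ :=
  ∑ k, (-1) ^ (k.rev : ℕ) * ((x k : ℕ) : ℤ)

theorem signedSum_ofFn {n : ℕ} (x : Fin n → ℕ) :
    signedSum (List.ofFn x) = ∑ k, (-1) ^ (k.rev : ℕ) * (x k : ℤ) := by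
  induction n with
  | zero => simp [signedSum]
  | succ n ih => simp [List.ofFn_succ, signedSum, ih, Fin.sum_univ_succ, Fin.val_rev]

theorem svetlichnyCoeff_ofFn {n m : ℕ} (hm : Even m) (hm0 : 0 < m) (hn : n ≠ 0)
    (x : Fin n → Fin m) :
    svetlichnyCoeff m (List.ofFn fun k => (x k : ℕ)) = squareWave m (phase x) := by
  rw [svetlichnyCoeff_eq_squareWave hm hm0, signedSum_ofFn, phase]
  · intro y hy
    obtain ⟨k, rfl⟩ := (List.mem_ofFn' _ _).1 hy
    exact (x k).2
  · simpa using hn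

/-! ### Half-period shifts of settings -/

/-- The setting with index `m/2`, half a turn in the cyclic group of settings. -/
def halfTurn (m : ℕ) [NeZero m] : Fin m := Fin.ofNat m (m / 2)

theorem halfTurn_val (m : ℕ) [NeZero m] : (halfTurn m : ℕ) = m / 2 := by
  have := NeZero.pos m
  simp only [halfTurn, Fin.val_ofNat]
  exact Nat.mod_eq_of_lt (by omega)

theorem phase_add_single {n m : ℕ} [NeZero m] (x : Fin n → Fin m) (p : Fin n) (t : Fin m) :
    phase (x + Pi.single p t) =
      phase x + (-1) ^ (p.rev : ℕ) * (((x p + t : Fin m) : ℕ) - ((x p : ℕ) : ℤ)) := by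
  rw [← sub_eq_iff_eq_add', phase, phase, ← Finset.sum_sub_distrib,
    Finset.sum_eq_single p (fun k _ hk => by simp [Pi.single_eq_of_ne hk]) (by simp)]
  simp [mul_sub]

theorem val_add_halfTurn {m : ℕ} [NeZero m] (hm : Even m) (y : Fin m) :
    ((y : ℕ) < m / 2 ∧ ((y + halfTurn m : Fin m) : ℕ) = y + m / 2) ∨
      (m / 2 ≤ (y : ℕ) ∧ ((y + halfTurn m : Fin m) : ℕ) + m / 2 = y) := by
  obtain ⟨h, rfl⟩ := hm
  have h2 : (h + h) / 2 = h := by omega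
  have := y.2
  rw [Fin.val_add, halfTurn_val, h2]
  rcases lt_or_ge (y : ℕ) h with hy | hy
  · left
    exact ⟨hy, Nat.mod_eq_of_lt (by omega)⟩
  · right
    refine ⟨hy, ?_⟩
    rw [Nat.mod_eq_sub_mod (by omega), Nat.mod_eq_of_lt (by omega)]
    omega

/-- A half-turn of one setting moves the phase by `m/2` in one of the two directions. -/
theorem phase_add_halfTurn {m : ℕ} [NeZero m] (hm : Even m) {n : ℕ} (p : Fin n) (y : Fin m) :
    (-1) ^ (p.rev : ℕ) * (((y + halfTurn m : Fin m) : ℕ) - ((y : ℕ) : ℤ)) = (m / 2 : ℕ) ∨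
    (-1) ^ (p.rev : ℕ) * (((y + halfTurn m : Fin m) : ℕ) - ((y : ℕ) : ℤ)) = -(m / 2 : ℕ) := by
  rcases val_add_halfTurn hm y with ⟨_, h⟩ | ⟨_, h⟩ <;>
  rcases neg_one_pow_eq_or ℤ (p.rev : ℕ) with h' | h' <;> rw [h'] <;> omega

/-- The coefficient as a real number. -/
noncomputable def realCoeff {n m : ℕ} (x : Fin n → Fin m) : ℝ :=
  (svetlichnyCoeff m (List.ofFn fun k => (x k : ℕ)) : ℝ)

theorem realCoeff_eq {n m : ℕ} (hm : Even m) (hm0 : 0 < m) (hn : n ≠ 0) (x : Fin n → Fin m) :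
    realCoeff x = ((squareWave m (phase x) : ℤ) : ℝ) := by
  rw [realCoeff, svetlichnyCoeff_ofFn hm hm0 hn]

theorem realCoeff_sq {n m : ℕ} (hm : Even m) (hm0 : 0 < m) (hn : n ≠ 0) (x : Fin n → Fin m) :
    realCoeff x ^ 2 = 1 := by
  rw [realCoeff_eq hm hm0 hn]
  rcases Int.units_eq_one_or (squareWave m (phase x)) with h | h <;> simp [h]

/-- Half-turns of the settings of two parties turn the coefficients into the sign pattern of a
Clauser–Horne–Shimony–Holt expression: the product of the four signs is `-1`. -/
theorem realCoeff_chsh {n m : ℕ} [NeZero m] (hm : Even m) {p q : Fin n} (hpq : p ≠ q)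
    (x : Fin n → Fin m) :
    realCoeff x * realCoeff (x + Pi.single p (halfTurn m)) *
      realCoeff (x + Pi.single q (halfTurn m)) *
      realCoeff (x + Pi.single p (halfTurn m) + Pi.single q (halfTurn m)) = -1 := by
  have hm0 := NeZero.pos m
  have hn : n ≠ 0 := by have := p.2; omega
  simp only [realCoeff_eq hm hm0 hn, phase_add_single]
  rw [Pi.add_apply, Pi.single_eq_of_ne hpq.symm, add_zero]
  have hq : ∀ s : ℤ, squareWave m (s - (m / 2 : ℕ)) = -squareWave m (s + (m / 2 : ℕ)) := fun s => by
    rw [← squareWave_sub_period hm0]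
    congr 1
    have := Nat.two_mul_div_two_of_even hm
    omega
  have h1 : ∀ s : ℤ, squareWave m (s + (m / 2 : ℕ) + (m / 2 : ℕ)) = -squareWave m s := fun s => by
    rw [← squareWave_add_period hm0]
    congr 1
    have := Nat.two_mul_div_two_of_even hm
    omega
  have key : ∀ a b : ℤˣ, ((a : ℤ) : ℝ) * ((b : ℤ) : ℝ) * ((b : ℤ) : ℝ) * ((a : ℤ) : ℝ) = 1 := by
    intro a b
    rcases Int.units_eq_one_or a with rfl | rfl <;> rcases Int.units_eq_one_or b with rfl | rfl <;>
      simp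
  have key' := key (squareWave m (phase x)) (squareWave m (phase x + (m / 2 : ℕ)))
  have h3 : ∀ s : ℤ, squareWave m (s - (m / 2 : ℕ) + (m / 2 : ℕ)) = squareWave m s := by simp
  rcases phase_add_halfTurn hm p (x p) with hp | hp <;>
  rcases phase_add_halfTurn hm q (x q) with hq' | hq' <;>
  simp only [hp, hq', ← sub_eq_add_neg, hq, h1, h3, Units.val_neg, Int.cast_neg] <;>
  linarith

/-- If a half-turn of party `p` leaves the coefficient unchanged, the coefficient is the one at the
setting `halfTurn m` of that party, which does not refer to the setting of `p` any more. -/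
theorem realCoeff_update_halfTurn {n m : ℕ} [NeZero m] (hm : Even m) (p : Fin n)
    (x : Fin n → Fin m) (h : realCoeff x = realCoeff (x + Pi.single p (halfTurn m))) :
    realCoeff (Function.update x p (halfTurn m)) = realCoeff x := by
  have hm0 := NeZero.pos m
  have hn : n ≠ 0 := by have := p.2; omega
  have hup : Function.update x p (halfTurn m) = x + Pi.single p (halfTurn m - x p) := by
    ext k
    by_cases hk : k = p
    · subst hk; simp
    · simp [hk]
  rw [realCoeff_eq hm hm0 hn, realCoeff_eq hm hm0 hn, phase_add_single] at h
  rw [hup, realCoeff_eq hm hm0 hn, realCoeff_eq hm hm0 hn, phase_add_single]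
  rw [add_sub_cancel, halfTurn_val]
  have h' : squareWave m (phase x) = _ := Units.ext (Int.cast_injective h)
  rw [Int.cast_inj, Units.val_inj]
  have hx := (x p).2
  have h2 := Nat.two_mul_div_two_of_even hm
  rcases val_add_halfTurn hm (x p) with ⟨hlt, hv⟩ | ⟨hlt, hv⟩ <;>
  rcases neg_one_pow_eq_or ℤ (p.rev : ℕ) with he | he <;> rw [he] at h' ⊢
  · refine squareWave_eq_of_between hm hm0 (by omega) (by omega) (h'.trans ?_)
    congr 1; omega
  · rw [h']
    refine squareWave_eq_of_between hm hm0 (by omega) (by omega) (h'.symm.trans ?_)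
    congr 1; omega
  · rw [h']
    refine squareWave_eq_of_between hm hm0 (by omega) (by omega) (h'.symm.trans ?_)
    congr 1; omega
  · refine squareWave_eq_of_between hm hm0 (by omega) (by omega) (h'.trans ?_)
    congr 1; omega

/-! ### Averaging over half-turns, and the bilocal bound -/

theorem four_mul_sum_eq_sum_block {G : Type*} [Fintype G] [AddCommGroup G] (F : G → ℝ) (d e : G) :
    4 * ∑ x, F x = ∑ x, (F x + F (x + d) + F (x + e) + F (x + d + e)) := by
  have h : ∀ t : G, ∑ x, F (x + t) = ∑ x, F x := fun t => Equiv.sum_comp (Equiv.addRight t) F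
  simp only [Finset.sum_add_distrib, add_assoc, h]
  ring

theorem eq_neg_mul_of_mul_eq_neg_one {a b c d : ℝ} (ha : a ^ 2 = 1) (hb : b ^ 2 = 1)
    (hc : c ^ 2 = 1) (habcd : a * b * c * d = -1) : d = -(a * b * c) := by
  linear_combination (a * b * c) * habcd - d * b ^ 2 * c ^ 2 * ha - d * c ^ 2 * hb - d * hc

/-- The CHSH inequality for four signs of product `-1`. -/
theorem chsh_le_two {a b c d q q' r r' : ℝ} (ha : a ^ 2 = 1) (hb : b ^ 2 = 1) (hc : c ^ 2 = 1)
    (habcd : a * b * c * d = -1) (hq : |q| ≤ 1) (hq' : |q'| ≤ 1) (hr : |r| ≤ 1) (hr' : |r'| ≤ 1) :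
    a * (q * r) + b * (q' * r) + c * (q * r') + d * (q' * r') ≤ 2 := by
  have hu : (a * q + b * q') * r ≤ |a * q + b * q'| :=
    (le_abs_self _).trans (by rw [abs_mul]; exact mul_le_of_le_one_right (abs_nonneg _) hr)
  have hv : (c * q + d * q') * r' ≤ |c * q + d * q'| :=
    (le_abs_self _).trans (by rw [abs_mul]; exact mul_le_of_le_one_right (abs_nonneg _) hr')
  obtain rfl := eq_neg_mul_of_mul_eq_neg_one ha hb hc habcd
  have huv : |a * q + b * q'| + |c * q + -(a * b * c) * q'| ≤ 2 := by
    rw [abs_le] at hq hq'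
    rcases sq_eq_one_iff.1 ha with rfl | rfl <;>
    rcases sq_eq_one_iff.1 hb with rfl | rfl <;>
    rcases sq_eq_one_iff.1 hc with rfl | rfl <;>
    grind
  linarith

theorem sum_pi_eq_sum_mul_sum {κ : Type*} [Fintype κ] [DecidableEq κ] {β : Type*} [Fintype β]
    (K : Finset κ) (f : ({i // i ∈ K} → β) → ℝ) (g : ({i // i ∉ K} → β) → ℝ) :
    ∑ a : κ → β, f (fun i => a i) * g (fun i => a i) = (∑ a, f a) * ∑ a, g a := by
  rw [Finset.sum_mul_sum, ← Fintype.sum_prod_type',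
    ← (Equiv.piEquivPiSubtypeProd (· ∈ K) fun _ => β).sum_comp]
  rfl

/-- The mean of the product of the outcomes. -/
noncomputable def meanOutcome {κ : Type*} [Fintype κ] [DecidableEq κ] {m : ℕ}
    (Q : (κ → Fin m) → (κ → ℤˣ) → ℝ) (x : κ → Fin m) : ℝ :=
  ∑ a, Q x a * (((∏ i, a i : ℤˣ) : ℤ) : ℝ)

theorem abs_meanOutcome_le_one {κ : Type*} [Fintype κ] [DecidableEq κ] {m : ℕ}
    {Q : (κ → Fin m) → (κ → ℤˣ) → ℝ} (hQ : IsConditionalDistribution Q) (x : κ → Fin m) :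
    |meanOutcome Q x| ≤ 1 := by
  rw [← (hQ x).2]
  refine (Finset.abs_sum_le_sum_abs _ _).trans (Finset.sum_le_sum fun a _ => ?_)
  rw [abs_mul, abs_of_nonneg ((hQ x).1 a)]
  rcases Int.units_eq_one_or (∏ i, a i) with h | h <;> simp [h]

theorem fullCorrelator_eq_mul {n m : ℕ} {K : Finset (Fin n)}
    {P : (Fin n → Fin m) → (Fin n → ℤˣ) → ℝ}
    {Q : ({i // i ∈ K} → Fin m) → ({i // i ∈ K} → ℤˣ) → ℝ}
    {R : ({i // i ∉ K} → Fin m) → ({i // i ∉ K} → ℤˣ) → ℝ}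
    (h : ∀ x a, P x a = Q (fun i => x i) (fun i => a i) * R (fun i => x i) (fun i => a i))
    (x : Fin n → Fin m) :
    fullCorrelator P x = meanOutcome Q (fun i => x i) * meanOutcome R (fun i => x i) := by
  rw [meanOutcome, meanOutcome, ← sum_pi_eq_sum_mul_sum, fullCorrelator]
  refine Finset.sum_congr rfl fun a _ => ?_
  have hprod : ∏ i, a i = (∏ i : {i // i ∈ K}, a i) * ∏ i : {i // i ∉ K}, a i := by
    rw [← Fintype.prod_subtype_mul_prod_subtype (· ∈ K) a]
    congr!
  rw [h, hprod, Units.val_mul, Int.cast_mul]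
  ring

theorem svetlichnyValue_eq {n m : ℕ} (E : (Fin n → Fin m) → ℝ) :
    svetlichnyValue E = ∑ x, realCoeff x * E x := rfl

theorem svetlichnyValue_le_of_factorizes {n m : ℕ} (hm : Even m) (hm0 : 0 < m)
    {K : Finset (Fin n)} (hK : K.Nonempty) (hK' : Kᶜ.Nonempty)
    {P : (Fin n → Fin m) → (Fin n → ℤˣ) → ℝ} (hP : FactorizesAcross K P) :
    svetlichnyValue (fullCorrelator P) ≤ (m : ℝ) ^ n / 2 := by
  have : NeZero m := ⟨hm0.ne'⟩
  obtain ⟨p, hp⟩ := hK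
  obtain ⟨q, hq⟩ := hK'
  rw [Finset.mem_compl] at hq
  have hpq : p ≠ q := fun h => hq (h ▸ hp)
  have hn : n ≠ 0 := by have := p.2; omega
  obtain ⟨Q, R, hQ, hR, h⟩ := hP
  have key : 4 * svetlichnyValue (fullCorrelator P) ≤ ∑ _x : Fin n → Fin m, (2 : ℝ) := by
    rw [svetlichnyValue_eq,
      four_mul_sum_eq_sum_block _ (Pi.single p (halfTurn m)) (Pi.single q (halfTurn m))]
    refine Finset.sum_le_sum fun x _ => ?_
    simp only [fullCorrelator_eq_mul h]
    have hQp : ∀ y : Fin n → Fin m, (fun i : {i // i ∈ K} =>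
        (y + Pi.single q (halfTurn m) : Fin n → Fin m) i) = fun i : {i // i ∈ K} => y i := fun y => by
      funext i
      have : (i : Fin n) ≠ q := fun h => hq (h ▸ i.2)
      simp [this]
    have hRq : ∀ y : Fin n → Fin m, (fun i : {i // i ∉ K} =>
        (y + Pi.single p (halfTurn m) : Fin n → Fin m) i) = fun i : {i // i ∉ K} => y i := fun y => by
      funext i
      have : (i : Fin n) ≠ p := fun h => i.2 (h ▸ hp)
      simp [this]
    have hRq' : (fun i : {i // i ∉ K} =>
        (x + Pi.single p (halfTurn m) + Pi.single q (halfTurn m) : Fin n → Fin m) i) =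
          fun i : {i // i ∉ K} => (x + Pi.single q (halfTurn m) : Fin n → Fin m) i := by
      rw [add_right_comm, hRq]
    rw [hQp, hQp, hRq, hRq']
    exact chsh_le_two (realCoeff_sq hm hm0 hn _) (realCoeff_sq hm hm0 hn _)
      (realCoeff_sq hm hm0 hn _) (realCoeff_chsh hm hpq x) (abs_meanOutcome_le_one hQ _)
      (abs_meanOutcome_le_one hQ _) (abs_meanOutcome_le_one hR _) (abs_meanOutcome_le_one hR _)
  simp at key
  linarith

theorem svetlichnyValue_le_of_bilocal {n m : ℕ} (hm : Even m) (hm0 : 0 < m)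
    {P : (Fin n → Fin m) → (Fin n → ℤˣ) → ℝ} (hP : P ∈ bilocalCorrelations n m) :
    svetlichnyValue (fullCorrelator P) ≤ (m : ℝ) ^ n / 2 := by
  have hlin : IsLinearMap ℝ fun P : (Fin n → Fin m) → (Fin n → ℤˣ) → ℝ =>
      svetlichnyValue (fullCorrelator P) := by
    constructor
    · intro P P'
      simp only [svetlichnyValue, fullCorrelator, Pi.add_apply, add_mul, mul_add,
        Finset.sum_add_distrib]
    · intro t P
      simp only [svetlichnyValue, fullCorrelator, Pi.smul_apply, smul_eq_mul, Finset.mul_sum]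
      exact Finset.sum_congr rfl fun _ _ => Finset.sum_congr rfl fun _ _ => by ring
  refine convexHull_min ?_ (convex_halfSpace_le hlin ((m : ℝ) ^ n / 2)) hP
  rintro P ⟨K, hK, hK', h⟩
  exact svetlichnyValue_le_of_factorizes hm hm0 hK hK' h

/-! ### A bilocal strategy attaining the bound -/

theorem abs_add_abs_eq_two {a b c d : ℝ} (ha : a ^ 2 = 1) (hb : b ^ 2 = 1) (hc : c ^ 2 = 1)
    (habcd : a * b * c * d = -1) : |a + b| + |c + d| = 2 := by
  obtain rfl := eq_neg_mul_of_mul_eq_neg_one ha hb hc habcd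
  rcases sq_eq_one_iff.1 ha with rfl | rfl <;>
  rcases sq_eq_one_iff.1 hb with rfl | rfl <;>
  rcases sq_eq_one_iff.1 hc with rfl | rfl <;>
  norm_num

/-- The coefficient with the setting of `p` replaced by `halfTurn m` has the sign of each coefficient
that does not cancel against its half-turn at `p`. Of the two pairs `{x, x + p}` and
`{x + q, x + p + q}` (with `+ p` for a half-turn at `p`) exactly one does not cancel. -/
theorem sum_realCoeff_mul_update {n m : ℕ} [NeZero m] (hm : Even m) {p q : Fin n} (hpq : p ≠ q) :
    ∑ x : Fin n → Fin m, realCoeff x * realCoeff (Function.update x p (halfTurn m)) =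
      (m : ℝ) ^ n / 2 := by
  have hm0 := NeZero.pos m
  have hn : n ≠ 0 := by have := p.2; omega
  have hup : ∀ x : Fin n → Fin m, Function.update (x + Pi.single p (halfTurn m)) p (halfTurn m) =
      Function.update x p (halfTurn m) := fun x => by
    ext k
    by_cases hk : k = p
    · subst hk; simp
    · simp [hk]
  have habs : ∀ x : Fin n → Fin m, realCoeff x * realCoeff (Function.update x p (halfTurn m)) +
      realCoeff (x + Pi.single p (halfTurn m)) *
        realCoeff (Function.update (x + Pi.single p (halfTurn m)) p (halfTurn m)) =
      |realCoeff x + realCoeff (x + Pi.single p (halfTurn m))| := fun x => by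
    rw [hup, ← add_mul]
    rcases sq_eq_sq_iff_eq_or_eq_neg.1 ((realCoeff_sq hm hm0 hn x).trans
      (realCoeff_sq hm hm0 hn (x + Pi.single p (halfTurn m))).symm) with h | h
    · rw [realCoeff_update_halfTurn hm p x h, ← h]
      rcases sq_eq_one_iff.1 (realCoeff_sq hm hm0 hn x) with h | h <;>
        rw [h] <;> norm_num
    · rw [h]; simp
  have key : 4 * ∑ x : Fin n → Fin m, realCoeff x * realCoeff (Function.update x p (halfTurn m)) =
      ∑ _x : Fin n → Fin m, (2 : ℝ) := by
    rw [four_mul_sum_eq_sum_block _ (Pi.single p (halfTurn m)) (Pi.single q (halfTurn m))]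
    refine Finset.sum_congr rfl fun x _ => ?_
    rw [add_right_comm x, add_assoc, habs, habs]
    refine abs_add_abs_eq_two (realCoeff_sq hm hm0 hn _) (realCoeff_sq hm hm0 hn _)
      (realCoeff_sq hm hm0 hn _) ?_
    rw [add_right_comm x]
    exact realCoeff_chsh hm hpq x
  simp at key
  linarith

/-- The point mass at the outcomes prescribed by `s`. -/
noncomputable def deterministic {κ : Type*} [Fintype κ] [DecidableEq κ] {m : ℕ}
    (s : (κ → Fin m) → (κ → ℤˣ)) (x : κ → Fin m) (a : κ → ℤˣ) : ℝ :=
  if a = s x then 1 else 0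

theorem isConditionalDistribution_deterministic {κ : Type*} [Fintype κ] [DecidableEq κ] {m : ℕ}
    (s : (κ → Fin m) → (κ → ℤˣ)) : IsConditionalDistribution (deterministic s) := by
  intro x
  refine ⟨fun a => ?_, by simp [deterministic]⟩
  rw [deterministic]
  split_ifs <;> norm_num

theorem fullCorrelator_deterministic {n m : ℕ} (s : (Fin n → Fin m) → (Fin n → ℤˣ))
    (x : Fin n → Fin m) :
    fullCorrelator (deterministic s) x = (((∏ i, s x i : ℤˣ) : ℤ) : ℝ) := by
  simp [fullCorrelator, deterministic]

theorem factorizesAcross_deterministic {n m : ℕ} {K : Finset (Fin n)}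
    (s : ({i // i ∈ K} → Fin m) → ({i // i ∈ K} → ℤˣ))
    (t : ({i // i ∉ K} → Fin m) → ({i // i ∉ K} → ℤˣ)) (u : (Fin n → Fin m) → (Fin n → ℤˣ))
    (hs : ∀ x, (fun i : {i // i ∈ K} => u x i) = s fun i => x i)
    (ht : ∀ x, (fun i : {i // i ∉ K} => u x i) = t fun i => x i) :
    FactorizesAcross K (deterministic u) := by
  refine ⟨deterministic s, deterministic t, isConditionalDistribution_deterministic s,
    isConditionalDistribution_deterministic t, fun x a => ?_⟩
  simp only [deterministic, ← hs, ← ht, ← ite_and, mul_ite, mul_one, mul_zero]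
  congr 1
  rw [eq_iff_iff, funext_iff, funext_iff, funext_iff]
  refine ⟨fun h => ⟨fun i => h i, fun i => h i⟩, fun h i => ?_⟩
  by_cases hi : i ∈ K
  · exact h.2 ⟨i, hi⟩
  · exact h.1 ⟨i, hi⟩

theorem exists_bilocal_svetlichnyValue_eq {n m : ℕ} (hm : Even m) (hm0 : 0 < m) (hn : 2 ≤ n) :
    ∃ P ∈ bilocalCorrelations n m, svetlichnyValue (fullCorrelator P) = (m : ℝ) ^ n / 2 := by
  have : NeZero m := ⟨hm0.ne'⟩
  let p : Fin n := ⟨0, by omega⟩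
  let q : Fin n := ⟨1, by omega⟩
  have hpq : p ≠ q := by simp [p, q]
  -- The outcome of party `q` carries the sign, all other outcomes are `1`.
  let r : (Fin n → Fin m) → ℤˣ := fun x =>
    squareWave m (phase (Function.update x p (halfTurn m)))
  let u : (Fin n → Fin m) → (Fin n → ℤˣ) := fun x => Pi.mulSingle q (r x)
  refine ⟨deterministic u, subset_convexHull ℝ _ ⟨{p}, by simp, ⟨q, by simp [hpq.symm]⟩, ?_⟩, ?_⟩
  · refine factorizesAcross_deterministic (fun _ => 1)
      (fun y i => u (fun k => if hk : k ∉ ({p} : Finset (Fin n)) then y ⟨k, hk⟩ else halfTurn m) i)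
      u (fun x => ?_) fun x => ?_
    · funext ⟨i, hi⟩
      obtain rfl : i = p := by simpa using hi
      simp [u, hpq]
    · funext i
      simp only [u, r]
      congr 3
      funext k
      by_cases hk : k = p
      · subst hk; simp
      · simp [hk]
  · rw [← sum_realCoeff_mul_update hm hpq, svetlichnyValue_eq]
    refine Finset.sum_congr rfl fun x _ => ?_
    rw [fullCorrelator_deterministic, Fintype.prod_pi_mulSingle',
      realCoeff_eq hm hm0 (by omega) (Function.update x p (halfTurn m))]

/-! ### Monogamy of the CHSH expression -/

section Monogamy

variable {H : Type*} [NormedAddCommGroup H] [InnerProductSpace ℂ H] [CompleteSpace H]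

/-- The real part of a state, a real-linear functional. -/
noncomputable def QuantumStrategy.expect {ι : Type*} {m : ℕ} (s : QuantumStrategy ι m H) :
    (H →L[ℂ] H) →ₗ[ℝ] ℝ :=
  Complex.reLm ∘ₗ s.state.restrictScalars ℝ

theorem QuantumStrategy.expect_one {ι : Type*} {m : ℕ} (s : QuantumStrategy ι m H) :
    s.expect 1 = 1 := by
  simp [QuantumStrategy.expect, s.state_one]

theorem QuantumStrategy.expect_sq_le {ι : Type*} {m : ℕ} (s : QuantumStrategy ι m H)
    {M : H →L[ℂ] H} (hM : IsSelfAdjoint M) : s.expect M ^ 2 ≤ s.expect (M * M) := by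
  have hs : star (M - s.expect M • 1) = M - s.expect M • 1 := by
    simp [star_sub, hM.star_eq, star_smul]
  have h : 0 ≤ s.expect ((M - s.expect M • 1) * (M - s.expect M • 1)) := by
    have := (s.state_nonneg (M - s.expect M • 1)).1
    rwa [hs] at this
  have he : (M - s.expect M • 1) * (M - s.expect M • 1) =
      M * M - (2 * s.expect M) • M + (s.expect M ^ 2) • (1 : H →L[ℂ] H) := by
    simp only [sub_mul, mul_sub, smul_mul_assoc, mul_smul_comm, one_mul, mul_one]
    module
  rw [he, map_add, map_sub, map_smul, map_smul, s.expect_one] at h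
  simp only [smul_eq_mul] at h
  linarith

/-- A `±1`-valued observable: a self-adjoint operator with square `1`. -/
def IsSignObservable (T : H →L[ℂ] H) : Prop := IsSelfAdjoint T ∧ T * T = 1

theorem IsSignObservable.mul {S T : H →L[ℂ] H} (hS : IsSignObservable S)
    (hT : IsSignObservable T) (h : Commute S T) : IsSignObservable (S * T) :=
  ⟨(hS.1.commute_iff hT.1).1 h, by rw [h.symm.mul_mul_mul_comm, hS.2, hT.2, one_mul]⟩

theorem IsSignObservable.smul {T : H →L[ℂ] H} (hT : IsSignObservable T) {a : ℝ}
    (ha : a ^ 2 = 1) : IsSignObservable (a • T) :=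
  ⟨by rw [IsSelfAdjoint, star_smul, hT.1.star_eq, star_trivial],
    by rw [smul_mul_smul_comm, hT.2, ← sq, ha, one_smul]⟩

/-- Monogamy of the CHSH expression, in the symmetric form
`(A₀ + A₁) B₀ + (A₀ - A₁) B₁`. For real `α`, `β` the operators
`α (A₀ + A₁) B₀ + β (A₀ - A₁) C₁` and `α (A₀ - A₁) B₁ + β (A₀ + A₁) C₀` add up to `α` times the
first expression plus `β` times the second. In each of them the two summands anticommute, because
`A₀ + A₁` and `A₀ - A₁` do, and so their squares add up to `4 (α² + β²)`. -/
theorem QuantumStrategy.chsh_monogamy {ι : Type*} {m : ℕ} (s : QuantumStrategy ι m H)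
    {A₀ A₁ B₀ B₁ C₀ C₁ : H →L[ℂ] H}
    (hA₀ : IsSignObservable A₀) (hA₁ : IsSignObservable A₁) (hB₀ : IsSignObservable B₀)
    (hB₁ : IsSignObservable B₁) (hC₀ : IsSignObservable C₀) (hC₁ : IsSignObservable C₁)
    (AB₀₀ : Commute A₀ B₀) (AB₀₁ : Commute A₀ B₁) (AB₁₀ : Commute A₁ B₀) (AB₁₁ : Commute A₁ B₁)
    (AC₀₀ : Commute A₀ C₀) (AC₀₁ : Commute A₀ C₁) (AC₁₀ : Commute A₁ C₀) (AC₁₁ : Commute A₁ C₁)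
    (BC₀₁ : Commute B₀ C₁) (BC₁₀ : Commute B₁ C₀) :
    s.expect ((A₀ + A₁) * B₀ + (A₀ - A₁) * B₁) ^ 2 +
      s.expect ((A₀ + A₁) * C₀ + (A₀ - A₁) * C₁) ^ 2 ≤ 8 := by
  obtain ⟨hA₀, sA₀⟩ := hA₀
  obtain ⟨hA₁, sA₁⟩ := hA₁
  obtain ⟨hB₀, sB₀⟩ := hB₀
  obtain ⟨hB₁, sB₁⟩ := hB₁
  obtain ⟨hC₀, sC₀⟩ := hC₀
  obtain ⟨hC₁, sC₁⟩ := hC₁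
  set α := s.expect ((A₀ + A₁) * B₀ + (A₀ - A₁) * B₁) with hα
  set β := s.expect ((A₀ + A₁) * C₀ + (A₀ - A₁) * C₁) with hβ
  -- Both combinations are of the form `α X B + β Y C` with anticommuting `X` and `Y`.
  have hsq : ∀ {X Y B C : H →L[ℂ] H}, X * Y = -(Y * X) → B * B = 1 → C * C = 1 → Commute X B →
      Commute X C → Commute Y B → Commute Y C → Commute B C →
      (α • (X * B) + β • (Y * C)) * (α • (X * B) + β • (Y * C)) =
        α ^ 2 • (X * X) + β ^ 2 • (Y * Y) := by
    intro X Y B C hXY hB hC hXB hXC hYB hYC hBC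
    have h1 : X * B * (X * B) = X * X := by
      rw [hXB.symm.mul_mul_mul_comm, hB, mul_one]
    have h2 : Y * C * (Y * C) = Y * Y := by
      rw [hYC.symm.mul_mul_mul_comm, hC, mul_one]
    have h3 : X * B * (Y * C) = -(Y * C * (X * B)) := by
      rw [hYB.symm.mul_mul_mul_comm, hXC.symm.mul_mul_mul_comm, hXY, hBC.eq, neg_mul]
    simp only [mul_add, add_mul, smul_mul_assoc, mul_smul_comm, h1, h2, h3]
    module
  have hsa : ∀ {X B : H →L[ℂ] H}, IsSelfAdjoint X → IsSelfAdjoint B → Commute X B →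
      IsSelfAdjoint (X * B) := fun hX hB h => (hX.commute_iff hB).1 h
  have hanti : (A₀ + A₁) * (A₀ - A₁) = -((A₀ - A₁) * (A₀ + A₁)) := by
    simp only [add_mul, mul_add, mul_sub, sub_mul, sA₀, sA₁]
    abel
  have hanti' : (A₀ - A₁) * (A₀ + A₁) = -((A₀ + A₁) * (A₀ - A₁)) := by rw [hanti, neg_neg]
  set X := A₀ + A₁ with hX
  set Y := A₀ - A₁ with hY
  have hXX : X * X + Y * Y = (4 : ℝ) • 1 := by
    simp only [hX, hY, add_mul, mul_add, mul_sub, sub_mul, sA₀, sA₁]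
    module
  have sX : IsSelfAdjoint X := hA₀.add hA₁
  have sY : IsSelfAdjoint Y := hA₀.sub hA₁
  have XB₀ : Commute X B₀ := AB₀₀.add_left AB₁₀
  have XB₁ : Commute X B₁ := AB₀₁.add_left AB₁₁
  have XC₀ : Commute X C₀ := AC₀₀.add_left AC₁₀
  have XC₁ : Commute X C₁ := AC₀₁.add_left AC₁₁
  have YB₀ : Commute Y B₀ := AB₀₀.sub_left AB₁₀
  have YB₁ : Commute Y B₁ := AB₀₁.sub_left AB₁₁
  have YC₀ : Commute Y C₀ := AC₀₀.sub_left AC₁₀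
  have YC₁ : Commute Y C₁ := AC₀₁.sub_left AC₁₁
  have real_smul : ∀ (t : ℝ) {T : H →L[ℂ] H}, IsSelfAdjoint T → IsSelfAdjoint (t • T) :=
    fun t T hT => by rw [IsSelfAdjoint, star_smul, hT.star_eq, star_trivial]
  have hM := s.expect_sq_le (M := α • (X * B₀) + β • (Y * C₁))
    ((real_smul α (hsa sX hB₀ XB₀)).add (real_smul β (hsa sY hC₁ YC₁)))
  have hN := s.expect_sq_le (M := α • (Y * B₁) + β • (X * C₀))
    ((real_smul α (hsa sY hB₁ YB₁)).add (real_smul β (hsa sX hC₀ XC₀)))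
  rw [hsq hanti sB₀ sC₁ XB₀ XC₁ YB₀ YC₁ BC₀₁] at hM
  rw [hsq hanti' sB₁ sC₀ YB₁ YC₀ XB₁ XC₀ BC₁₀] at hN
  have hXX' : s.expect (X * X) + s.expect (Y * Y) = 4 := by
    rw [← map_add, hXX, map_smul, s.expect_one, smul_eq_mul, mul_one]
  simp only [map_add, map_smul, smul_eq_mul] at hM hN hα hβ
  have hsum : (α ^ 2 + β ^ 2) ^ 2 ≤ 8 * (α ^ 2 + β ^ 2) := by
    have h1 : α ^ 2 + β ^ 2 = (α * s.expect (X * B₀) + β * s.expect (Y * C₁)) +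
        (α * s.expect (Y * B₁) + β * s.expect (X * C₀)) := by
      linear_combination α * hα + β * hβ
    have h2 : α ^ 2 * s.expect (X * X) + β ^ 2 * s.expect (Y * Y) +
        (α ^ 2 * s.expect (Y * Y) + β ^ 2 * s.expect (X * X)) = 4 * (α ^ 2 + β ^ 2) := by
      linear_combination (α ^ 2 + β ^ 2) * hXX'
    calc (α ^ 2 + β ^ 2) ^ 2 ≤ 2 * ((α * s.expect (X * B₀) + β * s.expect (Y * C₁)) ^ 2 +
        (α * s.expect (Y * B₁) + β * s.expect (X * C₀)) ^ 2) := by rw [h1]; exact add_sq_le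
      _ ≤ _ := by linarith
  nlinarith [sq_nonneg α, sq_nonneg β]

/-- A CHSH expression with an arbitrary sign pattern of product `-1` is brought to the symmetric form
by absorbing signs into the observables of the second party and possibly exchanging them. -/
theorem exists_symmetric_chsh {B₀ B₁ : H →L[ℂ] H} (hB₀ : IsSignObservable B₀)
    (hB₁ : IsSignObservable B₁) {a b c d : ℝ} (ha : a ^ 2 = 1) (hb : b ^ 2 = 1) (hc : c ^ 2 = 1)
    (habcd : a * b * c * d = -1) :
    ∃ D₀ D₁ : H →L[ℂ] H, IsSignObservable D₀ ∧ IsSignObservable D₁ ∧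
      (∀ T, Commute T B₀ → Commute T B₁ → Commute T D₀ ∧ Commute T D₁) ∧
      ∀ A₀ A₁ : H →L[ℂ] H, a • (A₀ * B₀) + b • (A₁ * B₀) + c • (A₀ * B₁) + d • (A₁ * B₁) =
        (A₀ + A₁) * D₀ + (A₀ - A₁) * D₁ := by
  obtain rfl := eq_neg_mul_of_mul_eq_neg_one ha hb hc habcd
  rcases sq_eq_sq_iff_eq_or_eq_neg.1 (hb.trans ha.symm) with rfl | rfl
  · refine ⟨b • B₀, c • B₁, hB₀.smul ha, hB₁.smul hc,
      fun T h0 h1 => ⟨h0.smul_right b, h1.smul_right c⟩, fun A₀ A₁ => ?_⟩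
    rw [show -(b * b * c) = -c by rw [← sq, ha, one_mul]]
    simp only [add_mul, sub_mul, mul_smul_comm]
    module
  · refine ⟨c • B₁, a • B₀, hB₁.smul hc, hB₀.smul ha,
      fun T h0 h1 => ⟨h1.smul_right c, h0.smul_right a⟩, fun A₀ A₁ => ?_⟩
    rw [show -(a * -a * c) = c by linear_combination c * ha]
    simp only [add_mul, sub_mul, mul_smul_comm]
    module

theorem QuantumStrategy.chsh_monogamy_of_signs {ι : Type*} {m : ℕ} (s : QuantumStrategy ι m H)
    {A₀ A₁ B₀ B₁ C₀ C₁ : H →L[ℂ] H}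
    (hA₀ : IsSignObservable A₀) (hA₁ : IsSignObservable A₁) (hB₀ : IsSignObservable B₀)
    (hB₁ : IsSignObservable B₁) (hC₀ : IsSignObservable C₀) (hC₁ : IsSignObservable C₁)
    (AB₀₀ : Commute A₀ B₀) (AB₀₁ : Commute A₀ B₁) (AB₁₀ : Commute A₁ B₀) (AB₁₁ : Commute A₁ B₁)
    (AC₀₀ : Commute A₀ C₀) (AC₀₁ : Commute A₀ C₁) (AC₁₀ : Commute A₁ C₀) (AC₁₁ : Commute A₁ C₁)
    (BC₀₀ : Commute B₀ C₀) (BC₀₁ : Commute B₀ C₁) (BC₁₀ : Commute B₁ C₀) (BC₁₁ : Commute B₁ C₁)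
    {a b c d a' b' c' d' : ℝ} (ha : a ^ 2 = 1) (hb : b ^ 2 = 1) (hc : c ^ 2 = 1)
    (habcd : a * b * c * d = -1) (ha' : a' ^ 2 = 1) (hb' : b' ^ 2 = 1) (hc' : c' ^ 2 = 1)
    (habcd' : a' * b' * c' * d' = -1) :
    (a * s.expect (A₀ * B₀) + b * s.expect (A₁ * B₀) + c * s.expect (A₀ * B₁) +
        d * s.expect (A₁ * B₁)) ^ 2 +
      (a' * s.expect (A₀ * C₀) + b' * s.expect (A₁ * C₀) + c' * s.expect (A₀ * C₁) +
        d' * s.expect (A₁ * C₁)) ^ 2 ≤ 8 := by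
  obtain ⟨D₀, D₁, hD₀, hD₁, hD, hDeq⟩ := exists_symmetric_chsh hB₀ hB₁ ha hb hc habcd
  obtain ⟨E₀, E₁, hE₀, hE₁, hE, hEeq⟩ := exists_symmetric_chsh hC₀ hC₁ ha' hb' hc' habcd'
  have hDC₀ := hD _ BC₀₀.symm BC₁₀.symm
  have hDC₁ := hD _ BC₀₁.symm BC₁₁.symm
  have hDE₀ := hE _ hDC₀.1.symm hDC₁.1.symm
  have hDE₁ := hE _ hDC₀.2.symm hDC₁.2.symm
  have h := s.chsh_monogamy hA₀ hA₁ hD₀ hD₁ hE₀ hE₁ (hD _ AB₀₀ AB₀₁).1 (hD _ AB₀₀ AB₀₁).2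
    (hD _ AB₁₀ AB₁₁).1 (hD _ AB₁₀ AB₁₁).2 (hE _ AC₀₀ AC₀₁).1 (hE _ AC₀₀ AC₀₁).2
    (hE _ AC₁₀ AC₁₁).1 (hE _ AC₁₀ AC₁₁).2 hDE₀.2 hDE₁.1
  rw [← hDeq, ← hEeq] at h
  simpa only [map_add, map_smul, smul_eq_mul] using h

end Monogamy

/-! ### Correlators as block sums -/

section Blocks

variable {ι : Type*} {m : ℕ} {H : Type*} [NormedAddCommGroup H] [InnerProductSpace ℂ H]
  [CompleteSpace H]

theorem QuantumStrategy.isSignObservable_obs (s : QuantumStrategy ι m H) (i : ι) (y : Fin m) :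
    IsSignObservable (s.obs i y) :=
  ⟨s.obs_selfAdjoint i y, s.obs_sq i y⟩

theorem IsSignObservable.noncommProd {κ : Type*} (t : Finset κ) (g : κ → (H →L[ℂ] H))
    (hg : ∀ k, IsSignObservable (g k)) (comm : (t : Set κ).Pairwise (Function.onFun Commute g)) :
    IsSignObservable (t.noncommProd g comm) := by
  classical
  induction t using Finset.induction_on with
  | empty => rw [Finset.noncommProd_empty]; exact ⟨IsSelfAdjoint.one _, one_mul 1⟩
  | insert a t ha ih =>
    rw [Finset.noncommProd_insert_of_notMem _ _ _ _ ha]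
    refine (hg a).mul (ih _) (Finset.noncommProd_commute _ _ _ _ fun k hk => ?_)
    exact comm (by simp) (by simp [hk]) fun h => ha (h ▸ hk)

/-- The product of the observables of `n` distinct parties, with those of two parties `p` and `q`
split off; the remaining factor does not see the settings of `p` and `q`. -/
theorem QuantumStrategy.exists_prod_eq (s : QuantumStrategy ι m H) {n : ℕ} {e : Fin n → ι}
    (he : Function.Injective e) (x : Fin n → Fin m) {p q : Fin n} (hpq : p ≠ q) :
    ∃ R : H →L[ℂ] H, IsSignObservable R ∧
      (∀ T, (∀ k, k ≠ p → k ≠ q → Commute T (s.obs (e k) (x k))) → Commute T R) ∧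
      ∀ y : Fin n → Fin m, (∀ k, k ≠ p → k ≠ q → y k = x k) →
        (List.ofFn fun k => s.obs (e k) (y k)).prod =
          s.obs (e p) (y p) * (s.obs (e q) (y q) * R) := by
  have comm : ∀ (y : Fin n → Fin m) (t : Finset (Fin n)),
      (t : Set (Fin n)).Pairwise (Function.onFun Commute fun k => s.obs (e k) (y k)) :=
    fun y t i _ j _ hij => s.obs_commute _ _ (he.ne hij) _ _
  refine ⟨((Finset.univ.erase p).erase q).noncommProd _ (comm x _),
    .noncommProd _ _ (fun k => s.isSignObservable_obs _ _) _, fun T hT => ?_, fun y hy => ?_⟩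
  · refine Finset.noncommProd_commute _ _ _ _ fun k hk => ?_
    simp only [Finset.mem_erase, Finset.mem_univ, and_true] at hk
    exact hT k hk.2 hk.1
  · have h : (List.ofFn fun k => s.obs (e k) (y k)).prod =
        Finset.univ.noncommProd _ (comm y _) := by
      rw [Finset.noncommProd]
      simp only [Fin.univ_val_map, Multiset.noncommProd_coe]
    have hp := Finset.mul_noncommProd_erase _ (Finset.mem_univ p) _ (comm y Finset.univ)
    have hq := Finset.mul_noncommProd_erase (Finset.univ.erase p)
      (Finset.mem_erase.2 ⟨hpq.symm, Finset.mem_univ q⟩) _ (comm y (Finset.univ.erase p))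
    refine h.trans (hp.symm.trans (congrArg _ (hq.symm.trans (congrArg _ ?_))))
    refine Finset.noncommProd_congr rfl (fun k hk => ?_) _
    simp only [Finset.mem_erase, Finset.mem_univ, and_true] at hk
    rw [hy k hk.2 hk.1]

/-- Averaging over the settings of all players of a larger set does not change a mean over the
settings of the players indexed by `f`. -/
theorem card_mul_sum_comp {A κ W : Type*} [AddCommGroup A] [Fintype A] [Fintype κ] [DecidableEq κ]
    [Fintype W] [DecidableEq W] {f : κ → W} (hf : Function.Injective f) (g : (κ → A) → ℝ) :
    (Fintype.card (κ → A) : ℝ) * ∑ X : W → A, g (X ∘ f) =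
      Fintype.card (W → A) * ∑ x, g x := by
  have h : ∀ x : κ → A, ∑ X : W → A, g (X ∘ f) = ∑ X : W → A, g (X ∘ f + x) := fun x => by
    rw [← Equiv.sum_comp (Equiv.addRight (Function.extend f x 0))]
    refine Finset.sum_congr rfl fun X _ => congrArg g ?_
    funext k
    simp [hf.extend_apply]
  have h' : ∀ X : W → A, ∑ x, g (X ∘ f + x) = ∑ x, g x := fun X =>
    Equiv.sum_comp (Equiv.addLeft (X ∘ f)) g
  calc _ = ∑ x : κ → A, ∑ X : W → A, g (X ∘ f + x) := by simp [← h]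
    _ = _ := by rw [Finset.sum_comm]; simp [h']

theorem single_comp_of_injective {A κ W : Type*} [Zero A] [DecidableEq κ] [DecidableEq W]
    {f : κ → W} (hf : Function.Injective f) (p : κ) (t : A) :
    (Pi.single (f p) t : W → A) ∘ f = Pi.single p t := by
  funext k
  by_cases hk : k = p
  · subst hk; simp
  · simp [hk, hf.ne hk]

theorem single_comp_of_notMem_range {A κ W : Type*} [Zero A] [DecidableEq W] {f : κ → W} {w : W}
    (hw : ∀ k, f k ≠ w) (t : A) : (Pi.single w t : W → A) ∘ f = 0 := by
  funext k
  simp [hw k]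

/-- A bound on the length of the sum of plane vectors of bounded length. -/
theorem sq_sum_add_sq_sum_le {G : Type*} [Fintype G] {a b : G → ℝ} {r : ℝ}
    (h : ∀ x, a x ^ 2 + b x ^ 2 ≤ r) :
    (∑ x, a x) ^ 2 + (∑ x, b x) ^ 2 ≤ r * (Fintype.card G : ℝ) ^ 2 := by
  have ha := sq_sum_le_card_mul_sum_sq (s := Finset.univ) (f := a)
  have hb := sq_sum_le_card_mul_sum_sq (s := Finset.univ) (f := b)
  have hab : ∑ x, a x ^ 2 + ∑ x, b x ^ 2 ≤ Fintype.card G * r := by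
    rw [← Finset.sum_add_distrib]
    exact (Finset.sum_le_sum fun x _ => h x).trans (by simp)
  rw [Finset.card_univ] at ha hb
  nlinarith [mul_le_mul_of_nonneg_left hab (Nat.cast_nonneg (α := ℝ) (Fintype.card G))]

/-- The monogamy relation for two injective families `v ∘ f₁`, `v ∘ f₂` of players with a common
member `f₁ p₁ = f₂ p₂`, each of which has a member (`f₁ q₁`, `f₂ q₂`) that the other does not have.
Both expressions are averaged over the settings `X` of all players; half-turns of the settings of
the common player and, simultaneously, of the two exclusive players split them into CHSH
expressions, which are monogamous for each `X`. -/
theorem QuantumStrategy.svetlichny_monogamy (s : QuantumStrategy ι m H) (hm : Even m)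
    (hm0 : 0 < m) {n : ℕ} {W : Type*} [Fintype W] {v : W → ι} (hv : Function.Injective v)
    {f₁ f₂ : Fin n → W} (hf₁ : Function.Injective f₁) (hf₂ : Function.Injective f₂)
    {p₁ p₂ q₁ q₂ : Fin n} (hp : f₁ p₁ = f₂ p₂) (hq₁ : ∀ k, f₂ k ≠ f₁ q₁)
    (hq₂ : ∀ k, f₁ k ≠ f₂ q₂) :
    svetlichnyValue (s.correlator fun k => v (f₁ k)) ^ 2 +
      svetlichnyValue (s.correlator fun k => v (f₂ k)) ^ 2 ≤ 2 * ((m : ℝ) ^ n / 2) ^ 2 := by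
  classical
  have : NeZero m := ⟨hm0.ne'⟩
  have hn : n ≠ 0 := by have := p₁.2; omega
  have hpq₁ : p₁ ≠ q₁ := fun h => hq₁ p₂ (by rw [← hp, h])
  have hpq₂ : p₂ ≠ q₂ := fun h => hq₂ p₁ (by rw [hp, h])
  have hve₁ : Function.Injective fun k => v (f₁ k) := hv.comp hf₁
  have hve₂ : Function.Injective fun k => v (f₂ k) := hv.comp hf₂
  let F₁ : (W → Fin m) → ℝ := fun X =>
    realCoeff (X ∘ f₁) * s.correlator (fun k => v (f₁ k)) (X ∘ f₁)
  let F₂ : (W → Fin m) → ℝ := fun X =>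
    realCoeff (X ∘ f₂) * s.correlator (fun k => v (f₂ k)) (X ∘ f₂)
  let d : W → Fin m := Pi.single (f₁ p₁) (halfTurn m)
  let e : W → Fin m := Pi.single (f₁ q₁) (halfTurn m) + Pi.single (f₂ q₂) (halfTurn m)
  have hd₁ : ∀ X : W → Fin m, (X + d) ∘ f₁ = X ∘ f₁ + Pi.single p₁ (halfTurn m) := fun X => by
    rw [← single_comp_of_injective hf₁]; rfl
  have hd₂ : ∀ X : W → Fin m, (X + d) ∘ f₂ = X ∘ f₂ + Pi.single p₂ (halfTurn m) := fun X => by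
    rw [← single_comp_of_injective hf₂, ← hp]; rfl
  have he₁ : ∀ X : W → Fin m, (X + e) ∘ f₁ = X ∘ f₁ + Pi.single q₁ (halfTurn m) := fun X => by
    rw [← add_zero (Pi.single q₁ _), ← single_comp_of_injective hf₁,
      ← single_comp_of_notMem_range hq₂ (halfTurn m)]; rfl
  have he₂ : ∀ X : W → Fin m, (X + e) ∘ f₂ = X ∘ f₂ + Pi.single q₂ (halfTurn m) := fun X => by
    rw [← zero_add (Pi.single q₂ _), ← single_comp_of_injective hf₂,
      ← single_comp_of_notMem_range hq₁ (halfTurn m)]; rfl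
  have hblock : ∀ X, (F₁ X + F₁ (X + d) + F₁ (X + e) + F₁ (X + d + e)) ^ 2 +
      (F₂ X + F₂ (X + d) + F₂ (X + e) + F₂ (X + d + e)) ^ 2 ≤ 8 := by
    intro X
    obtain ⟨R, hR, hRc, hRe⟩ := s.exists_prod_eq hve₁ (X ∘ f₁) hpq₁
    obtain ⟨S, hS, hSc, hSe⟩ := s.exists_prod_eq hve₂ (X ∘ f₂) hpq₂
    have hcorr₁ : ∀ y : Fin n → Fin m, (∀ k, k ≠ p₁ → k ≠ q₁ → y k = (X ∘ f₁) k) →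
        s.correlator (fun k => v (f₁ k)) y =
          s.expect (s.obs (v (f₁ p₁)) (y p₁) * (s.obs (v (f₁ q₁)) (y q₁) * R)) := fun y hy => by
      rw [← hRe y hy]; rfl
    have hcorr₂ : ∀ y : Fin n → Fin m, (∀ k, k ≠ p₂ → k ≠ q₂ → y k = (X ∘ f₂) k) →
        s.correlator (fun k => v (f₂ k)) y =
          s.expect (s.obs (v (f₁ p₁)) (y p₂) * (s.obs (v (f₂ q₂)) (y q₂) * S)) := fun y hy => by
      rw [hp, ← hSe y hy]; rfl
    -- The observables of the exclusive players, multiplied by those of the remaining players.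
    have hobsR : ∀ i, (∀ k, k ≠ p₁ → k ≠ q₁ → f₁ k ≠ i) → ∀ y, Commute (s.obs (v i) y) R :=
      fun i hi y => hRc _ fun k hk hk' => s.obs_commute _ _ (hv.ne (hi k hk hk').symm) _ _
    have hobsS : ∀ i, (∀ k, k ≠ p₂ → k ≠ q₂ → f₂ k ≠ i) → ∀ y, Commute (s.obs (v i) y) S :=
      fun i hi y => hSc _ fun k hk hk' => s.obs_commute _ _ (hv.ne (hi k hk hk').symm) _ _
    have hRS : Commute R S := by
      refine hSc _ fun k _ _ => (hRc _ fun l _ _ => ?_).symm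
      -- A player of both families measures the same observable in both, by the choice of `X`.
      by_cases h : f₂ k = f₁ l
      · simp only [Function.comp_apply, h]; exact Commute.refl _
      · exact s.obs_commute _ _ (hv.ne h) _ _
    have hq₁R : ∀ y, Commute (s.obs (v (f₁ q₁)) y) R := hobsR _ fun k _ hk => hf₁.ne hk
    have hq₂S : ∀ y, Commute (s.obs (v (f₂ q₂)) y) S := hobsS _ fun k _ hk => hf₂.ne hk
    have hq₂R : ∀ y, Commute (s.obs (v (f₂ q₂)) y) R := hobsR _ fun k _ _ => hq₂ k
    have hq₁S : ∀ y, Commute (s.obs (v (f₁ q₁)) y) S := hobsS _ fun k _ _ => hq₁ k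
    have hpR : ∀ y, Commute (s.obs (v (f₁ p₁)) y) R := hobsR _ fun k hk _ => hf₁.ne hk
    have hpS : ∀ y, Commute (s.obs (v (f₁ p₁)) y) S :=
      hobsS _ fun k hk _ => hp ▸ hf₂.ne hk
    have hAB : ∀ y z, Commute (s.obs (v (f₁ p₁)) y) (s.obs (v (f₁ q₁)) z * R) := fun y z =>
      (s.obs_commute _ _ (hve₁.ne hpq₁) _ _).mul_right (hpR y)
    have hAC : ∀ y z, Commute (s.obs (v (f₁ p₁)) y) (s.obs (v (f₂ q₂)) z * S) := fun y z =>
      (s.obs_commute _ _ (hv.ne (hq₂ p₁)) _ _).mul_right (hpS y)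
    have hBC : ∀ y z, Commute (s.obs (v (f₁ q₁)) y * R) (s.obs (v (f₂ q₂)) z * S) := fun y z =>
      ((s.obs_commute _ _ (hv.ne (hq₂ q₁)) _ _).mul_right (hq₁S y)).mul_left
        ((hq₂R z).symm.mul_right hRS)
    have hB : ∀ y, IsSignObservable (s.obs (v (f₁ q₁)) y * R) := fun y =>
      (s.isSignObservable_obs _ _).mul hR (hq₁R y)
    have hC : ∀ y, IsSignObservable (s.obs (v (f₂ q₂)) y * S) := fun y =>
      (s.isSignObservable_obs _ _).mul hS (hq₂S y)
    simp only [F₁, F₂, hd₁, hd₂, he₁, he₂]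
    have hoff : ∀ {p q : Fin n} (x : Fin n → Fin m) (k : Fin n), k ≠ p → k ≠ q →
        (x + Pi.single p (halfTurn m) : Fin n → Fin m) k = x k ∧
        (x + Pi.single q (halfTurn m) : Fin n → Fin m) k = x k ∧
        (x + Pi.single p (halfTurn m) + Pi.single q (halfTurn m) : Fin n → Fin m) k = x k := by
      intro p q x k hk hk'
      simp [hk, hk']
    rw [hcorr₁ _ fun _ _ _ => rfl, hcorr₁ _ fun k hk hk' => (hoff _ k hk hk').1,
      hcorr₁ _ fun k hk hk' => (hoff _ k hk hk').2.1,
      hcorr₁ _ fun k hk hk' => (hoff _ k hk hk').2.2,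
      hcorr₂ _ fun _ _ _ => rfl, hcorr₂ _ fun k hk hk' => (hoff _ k hk hk').1,
      hcorr₂ _ fun k hk hk' => (hoff _ k hk hk').2.1,
      hcorr₂ _ fun k hk hk' => (hoff _ k hk hk').2.2]
    simp only [Pi.add_apply, Pi.single_eq_same, Pi.single_eq_of_ne hpq₁,
      Pi.single_eq_of_ne hpq₁.symm, Pi.single_eq_of_ne hpq₂, Pi.single_eq_of_ne hpq₂.symm, add_zero]
    simp only [Function.comp_apply, ← hp]
    exact s.chsh_monogamy_of_signs (s.isSignObservable_obs _ _) (s.isSignObservable_obs _ _)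
      (hB _) (hB _) (hC _) (hC _) (hAB _ _) (hAB _ _) (hAB _ _) (hAB _ _)
      (hAC _ _) (hAC _ _) (hAC _ _) (hAC _ _) (hBC _ _) (hBC _ _) (hBC _ _) (hBC _ _)
      (realCoeff_sq hm hm0 hn _) (realCoeff_sq hm hm0 hn _) (realCoeff_sq hm hm0 hn _)
      (realCoeff_chsh hm hpq₁ _) (realCoeff_sq hm hm0 hn _) (realCoeff_sq hm hm0 hn _)
      (realCoeff_sq hm hm0 hn _) (realCoeff_chsh hm hpq₂ _)
  have hsum := sq_sum_add_sq_sum_le hblock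
  rw [← four_mul_sum_eq_sum_block, ← four_mul_sum_eq_sum_block] at hsum
  have h₁ : _ = _ * svetlichnyValue (s.correlator fun k => v (f₁ k)) :=
    card_mul_sum_comp hf₁ fun x => realCoeff x * s.correlator (fun k => v (f₁ k)) x
  have h₂ : _ = _ * svetlichnyValue (s.correlator fun k => v (f₂ k)) :=
    card_mul_sum_comp hf₂ fun x => realCoeff x * s.correlator (fun k => v (f₂ k)) x
  have hN : (0 : ℝ) < Fintype.card (W → Fin m) := by exact_mod_cast Fintype.card_pos
  change _ * ∑ X, F₁ X = _ at h₁
  change _ * ∑ X, F₂ X = _ at h₂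
  have hcard : (Fintype.card (Fin n → Fin m) : ℝ) = (m : ℝ) ^ n := by simp
  rw [hcard] at h₁ h₂
  generalize (Fintype.card (W → Fin m) : ℝ) = N at *
  generalize svetlichnyValue (s.correlator fun k => v (f₁ k)) = V₁ at *
  generalize svetlichnyValue (s.correlator fun k => v (f₂ k)) = V₂ at *
  refine le_of_mul_le_mul_left ?_ (pow_pos hN 2)
  calc N ^ 2 * (V₁ ^ 2 + V₂ ^ 2) = (N * V₁) ^ 2 + (N * V₂) ^ 2 := by ring
    _ = ((m : ℝ) ^ n) ^ 2 / 16 * ((4 * ∑ X, F₁ X) ^ 2 + (4 * ∑ X, F₂ X) ^ 2) := by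
        rw [← h₁, ← h₂]; ring
    _ ≤ ((m : ℝ) ^ n) ^ 2 / 16 * (8 * N ^ 2) := by gcongr
    _ = N ^ 2 * (2 * ((m : ℝ) ^ n / 2) ^ 2) := by ring

end Blocks

theorem mainTheorem4 {ι : Type*} (n m : ℕ) (hn : Even n) (hm : Even m) (hm0 : 0 < m)
    (P₁ P₂ : Finset ι) (e₁ : Fin n ≃ P₁) (e₂ : Fin n ≃ P₂)
    (hne : P₁ ≠ P₂) (hinter : ∃ i, i ∈ P₁ ∧ i ∈ P₂) :
    IsGreatest ((fun P => svetlichnyValue (fullCorrelator P)) '' bilocalCorrelations n m)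
      ((m : ℝ) ^ n / 2) ∧
    ∀ {H : Type*} [NormedAddCommGroup H] [InnerProductSpace ℂ H] [CompleteSpace H]
      (s : QuantumStrategy ι m H),
      svetlichnyValue (s.correlator fun k => (e₁ k : ι)) ^ 2 +
          svetlichnyValue (s.correlator fun k => (e₂ k : ι)) ^ 2 ≤
        2 * ((m : ℝ) ^ n / 2) ^ 2 ∧
      ((m : ℝ) ^ n / 2 < |svetlichnyValue (s.correlator fun k => (e₁ k : ι))| →
        |svetlichnyValue (s.correlator fun k => (e₂ k : ι))| < (m : ℝ) ^ n / 2) := by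
  classical
  obtain ⟨i, hi₁, hi₂⟩ := hinter
  have hn2 : 2 ≤ n := by
    have h0 : 0 < n := (e₁.symm ⟨i, hi₁⟩).pos
    obtain ⟨l, rfl⟩ := hn
    omega
  refine ⟨⟨?_, ?_⟩, ?_⟩
  · obtain ⟨P, hP, h⟩ := exists_bilocal_svetlichnyValue_eq hm hm0 hn2
    exact ⟨P, hP, h⟩
  · rintro _ ⟨P, hP, rfl⟩
    exact svetlichnyValue_le_of_bilocal hm hm0 hP
  intro H _ _ _ s
  have hc₁ : P₁.card = n := by simpa using (Fintype.card_congr e₁).symm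
  have hc₂ : P₂.card = n := by simpa using (Fintype.card_congr e₂).symm
  -- Distinct sets of the same size each have a member that the other does not have.
  obtain ⟨j, hj₁, hj₂⟩ : ∃ j ∈ P₁, j ∉ P₂ := by
    by_contra! h
    exact hne (Finset.eq_of_subset_of_card_le h (by omega))
  obtain ⟨k, hk₂, hk₁⟩ : ∃ k ∈ P₂, k ∉ P₁ := by
    by_contra! h
    exact hne (Finset.eq_of_subset_of_card_le h (by omega)).symm
  have hmono := s.svetlichny_monogamy hm hm0 (W := {i // i ∈ P₁ ∪ P₂}) Subtype.val_injective
    (f₁ := fun l => ⟨e₁ l, Finset.mem_union_left _ (e₁ l).2⟩)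
    (f₂ := fun l => ⟨e₂ l, Finset.mem_union_right _ (e₂ l).2⟩)
    (fun a b h => e₁.injective (Subtype.ext (Subtype.mk.inj h)))
    (fun a b h => e₂.injective (Subtype.ext (Subtype.mk.inj h)))
    (p₁ := e₁.symm ⟨i, hi₁⟩) (p₂ := e₂.symm ⟨i, hi₂⟩) (q₁ := e₁.symm ⟨j, hj₁⟩)
    (q₂ := e₂.symm ⟨k, hk₂⟩) (by simp)
    (fun l h => hj₂ (by
      have h' : ((e₂ l : P₂) : ι) = j := by simpa using h
      exact h' ▸ (e₂ l).2))
    (fun l h => hk₁ (by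
      have h' : ((e₁ l : P₁) : ι) = k := by simpa using h
      exact h' ▸ (e₁ l).2))
  refine ⟨hmono, fun hlt => ?_⟩
  have hβ : (0 : ℝ) ≤ (m : ℝ) ^ n / 2 := by positivity
  have h1 := pow_lt_pow_left₀ hlt hβ two_ne_zero
  rw [sq_abs] at h1
  exact abs_lt_of_sq_lt_sq (by linarith) hβ
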